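/- Let $|\psi\rangle\in\mathbb{C}^2\otimes\mathbb{C}^2\otimes\mathbb{C}^2$ be a pure state of three qubits $A,B,C$, i.e. $\langle\psi|\psi\rangle=1$. Let $\rho_{BC}=\mathrm{Tr}_A|\psi\rangle\langle\psi|$ be its reduced density matrix on $BC$, let $\rho_{BC}^{\Gamma}$ be the partial transpose of $\rho_{BC}$ with respect to one of the two qubits (say $C$), and let $$I_5(\psi)=\mathrm{Tr}\big[(\rho_{BC}^{\Gamma})^3\big],$$ which is a real number. Then $$I_5(\psi)\ge\frac{2}{9},$$ and equality holds if and only if $|\psi\rangle$ is LU-equivalent to the $W$ state $$|W\rangle=\frac{1}{\sqrt3}\big(|100\rangle+|010\rangle+|001\rangle\big),$$ that is, if and only if there are unitary $2\times2$ matrices $U_A,U_B,U_C$ with $|W\rangle=(U_A\otimes U_B\otimes U_C)|\psi\rangle$. -/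

import Mathlib

namespace ThreeQubit

open scoped Kronecker Matrix

/-- The Hilbert space of three qubits `A`, `B`, `C`: the space `ℂ² ⊗ ℂ² ⊗ ℂ²`, realised as `ℂ⁸` with
the computational basis `|abc⟩` indexed by `(a, b, c)`. -/
abbrev Space : Type := EuclideanSpace ℂ (Fin 2 × Fin 2 × Fin 2)

/-- The computational basis vector `|abc⟩`. -/
noncomputable def ket (a b c : Fin 2) : Space := EuclideanSpace.single (a, b, c) 1

/-- The `W` state `(|100⟩ + |010⟩ + |001⟩) / √3`. -/
noncomputable def wState : Space :=
  ((Real.sqrt 3 : ℝ) : ℂ)⁻¹ • (ket 1 0 0 + ket 0 1 0 + ket 0 0 1)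

/-- The projector `|ψ⟩⟨ψ|`. -/
def proj (ψ : Space) : Matrix (Fin 2 × Fin 2 × Fin 2) (Fin 2 × Fin 2 × Fin 2) ℂ :=
  Matrix.vecMulVec ψ.ofLp (star ψ.ofLp)

/-- Partial trace over the first qubit `A`. -/
def traceA (M : Matrix (Fin 2 × Fin 2 × Fin 2) (Fin 2 × Fin 2 × Fin 2) ℂ) :
    Matrix (Fin 2 × Fin 2) (Fin 2 × Fin 2) ℂ :=
  Matrix.of fun p q => ∑ a : Fin 2, M (a, p) (a, q)

/-- The reduced density matrix `ρ_BC = Tr_A |ψ⟩⟨ψ|`. -/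
def rhoBC (ψ : Space) : Matrix (Fin 2 × Fin 2) (Fin 2 × Fin 2) ℂ := traceA (proj ψ)

/-- Partial transpose with respect to the second tensor factor:
`⟨b c| M^Γ |b' c'⟩ = ⟨b c'| M |b' c⟩`. -/
def partialTranspose (M : Matrix (Fin 2 × Fin 2) (Fin 2 × Fin 2) ℂ) :
    Matrix (Fin 2 × Fin 2) (Fin 2 × Fin 2) ℂ :=
  Matrix.of fun p q => M (p.1, q.2) (q.1, p.2)

/-- The third-order negativity `I₅ = Tr[(ρ_BC^Γ)³]`. The trace is a real number, see
`coe_I5`, so that passing to its real part loses nothing. -/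
noncomputable def I5 (ψ : Space) : ℝ :=
  (Matrix.trace (partialTranspose (rhoBC ψ) ^ 3)).re

/-- The third-order negativity is the trace itself: that trace is real. -/
theorem coe_I5 (ψ : Space) :
    (I5 ψ : ℂ) = Matrix.trace (partialTranspose (rhoBC ψ) ^ 3) := by
  have hH : (partialTranspose (rhoBC ψ)).IsHermitian := by
    ext p q
    simp [partialTranspose, rhoBC, traceA, proj, Matrix.vecMulVec_apply, mul_comm]
  have h3 : (partialTranspose (rhoBC ψ) ^ 3).IsHermitian := hH.pow 3
  have ht : star (Matrix.trace (partialTranspose (rhoBC ψ) ^ 3))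
      = Matrix.trace (partialTranspose (rhoBC ψ) ^ 3) := by
    rw [← Matrix.trace_conjTranspose, h3.eq]
  exact Complex.conj_eq_iff_re.mp ht

/-- `ψ` and `φ` are equivalent under local unitaries: `φ = (U ⊗ V ⊗ W) ψ` for some unitary
`2 × 2` matrices `U`, `V`, `W`. -/
def LUEquivalent (ψ φ : Space) : Prop :=
  ∃ U ∈ Matrix.unitaryGroup (Fin 2) ℂ, ∃ V ∈ Matrix.unitaryGroup (Fin 2) ℂ,
    ∃ W ∈ Matrix.unitaryGroup (Fin 2) ℂ,
      φ = WithLp.toLp 2 ((U ⊗ₖ (V ⊗ₖ W)) *ᵥ ψ.ofLp)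

end ThreeQubit

namespace ThreeQubit

open scoped Kronecker Matrix

/-! `I5` is Kempe's invariant: for each pair of qubits X, Y it equals 3 Tr[(ρ_X ⊗ ρ_Y) ρ_XY] − Tr
ρ_X³ − Tr ρ_Y³ (`kempe_AB`, `kempe_AC`, `kempe_BC`). It is invariant under local unitaries
(`I5_localAct`), so the one-qubit marginals may be taken diagonal (`exists_diagonal_marginals`), and
then it depends only on the distribution of the squared amplitudes.

With biases a, b, c ≥ 0 of the three bits and pair correlations u, v, w, the three formulas become
(4 `I5` − 1)/3 = abu = acv = bcw. Two linear bounds on u + v + w together with AM-GM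
(`bloch_inequality`) exclude `I5` < 2/9. Equality forces the distribution of W, and diagonal phases
then carry the state to W. -/

theorem trace_pow_three {n R : Type*} [Fintype n] [DecidableEq n] [CommRing R] (M : Matrix n n R) :
    Matrix.trace (M ^ 3) = ∑ p, ∑ q, ∑ r, M p q * M q r * M r p := by
  simp only [pow_succ, pow_zero, one_mul, Matrix.trace, Matrix.diag_apply, Matrix.mul_apply,
    Finset.sum_mul]
  exact Finset.sum_congr rfl fun p _ => Finset.sum_comm

/-! ### Local operators and invariance of `I5` -/

/-- The amplitudes as a matrix with rows indexed by the qubit `A`. -/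
def matA (ψ : Space) : Matrix (Fin 2) (Fin 2 × Fin 2) ℂ := Matrix.of fun a p => ψ (a, p.1, p.2)

/-- The amplitudes as a matrix with rows indexed by the qubit `B`. -/
def matB (ψ : Space) : Matrix (Fin 2) (Fin 2 × Fin 2) ℂ := Matrix.of fun b p => ψ (p.1, b, p.2)

/-- The amplitudes as a matrix with rows indexed by the qubit `C`. -/
def matC (ψ : Space) : Matrix (Fin 2) (Fin 2 × Fin 2) ℂ := Matrix.of fun c p => ψ (p.1, p.2, c)

/-- The action of a product of local operators. -/
noncomputable def localAct (U V W : Matrix (Fin 2) (Fin 2) ℂ) (ψ : Space) : Space :=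
  WithLp.toLp 2 ((U ⊗ₖ (V ⊗ₖ W)) *ᵥ ψ.ofLp)

theorem matA_localAct (U V W : Matrix (Fin 2) (Fin 2) ℂ) (ψ : Space) :
    matA (localAct U V W ψ) = U * matA ψ * (V ⊗ₖ W)ᵀ := by
  ext i ⟨j, k⟩
  simp [matA, localAct, Matrix.mul_apply, Matrix.mulVec, dotProduct, Fintype.sum_prod_type,
    Fin.sum_univ_two]
  ring

theorem matB_localAct (U V W : Matrix (Fin 2) (Fin 2) ℂ) (ψ : Space) :
    matB (localAct U V W ψ) = V * matB ψ * (U ⊗ₖ W)ᵀ := by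
  ext i ⟨j, k⟩
  simp [matB, localAct, Matrix.mul_apply, Matrix.mulVec, dotProduct, Fintype.sum_prod_type,
    Fin.sum_univ_two]
  ring

theorem matC_localAct (U V W : Matrix (Fin 2) (Fin 2) ℂ) (ψ : Space) :
    matC (localAct U V W ψ) = W * matC ψ * (U ⊗ₖ V)ᵀ := by
  ext i ⟨j, k⟩
  simp [matC, localAct, Matrix.mul_apply, Matrix.mulVec, dotProduct, Fintype.sum_prod_type,
    Fin.sum_univ_two]
  ring

theorem localAct_localAct (U V W U' V' W' : Matrix (Fin 2) (Fin 2) ℂ) (ψ : Space) :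
    localAct U V W (localAct U' V' W' ψ) = localAct (U * U') (V * V') (W * W') ψ := by
  simp [localAct, Matrix.mulVec_mulVec, Matrix.mul_kronecker_mul]

theorem rhoBC_eq (ψ : Space) : rhoBC ψ = (matA ψ)ᵀ * ((matA ψ)ᵀ)ᴴ := by
  ext ⟨i, j⟩ ⟨k, l⟩
  simp [rhoBC, traceA, proj, matA, Matrix.vecMulVec_apply, Matrix.mul_apply]

theorem partialTranspose_conj (V W : Matrix (Fin 2) (Fin 2) ℂ)
    (M : Matrix (Fin 2 × Fin 2) (Fin 2 × Fin 2) ℂ) :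
    partialTranspose ((V ⊗ₖ W) * M * (V ⊗ₖ W)ᴴ) =
      (V ⊗ₖ W.map star) * partialTranspose M * (V ⊗ₖ W.map star)ᴴ := by
  ext ⟨i, j⟩ ⟨k, l⟩
  simp [partialTranspose, Matrix.mul_apply, Fintype.sum_prod_type, Fin.sum_univ_two]
  ring

theorem kronecker_isometry {m n : Type*} [Fintype m] [Fintype n] [DecidableEq m] [DecidableEq n]
    {V : Matrix m m ℂ} {W : Matrix n n ℂ} (hV : Vᴴ * V = 1) (hW : Wᴴ * W = 1) :
    (V ⊗ₖ W)ᴴ * (V ⊗ₖ W) = 1 := by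
  rw [Matrix.conjTranspose_kronecker, ← Matrix.mul_kronecker_mul, hV, hW, Matrix.one_kronecker_one]

theorem map_star_isometry {n : Type*} [Fintype n] [DecidableEq n] {W : Matrix n n ℂ}
    (hW : Wᴴ * W = 1) : (W.map star)ᴴ * W.map star = 1 := by
  have h := congrArg (fun M => Matrix.map M (starRingEnd ℂ)) hW
  simp only [Matrix.map_mul] at h
  rw [Matrix.map_one _ (map_zero _) (map_one _)] at h
  exact h

theorem transpose_isometry {n : Type*} [Fintype n] [DecidableEq n] {W : Matrix n n ℂ}
    (hW : Wᴴ * W = 1) : Wᵀ * Wᵀᴴ = 1 := by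
  have h := congrArg Matrix.transpose hW
  rwa [Matrix.transpose_mul, Matrix.transpose_one] at h

/-- `U` cancels in the partial trace. On the partial transpose `V ⊗ W` acts as `V` tensored with the
entrywise conjugate of `W`, still an isometry, so the trace of the cube is unchanged. -/
theorem I5_localAct {U V W : Matrix (Fin 2) (Fin 2) ℂ} (hU : Uᴴ * U = 1) (hV : Vᴴ * V = 1)
    (hW : Wᴴ * W = 1) (ψ : Space) : I5 (localAct U V W ψ) = I5 ψ := by
  have hρ : rhoBC (localAct U V W ψ) = (V ⊗ₖ W) * rhoBC ψ * (V ⊗ₖ W)ᴴ := by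
    rw [rhoBC_eq, rhoBC_eq, matA_localAct]
    simp only [Matrix.transpose_mul, Matrix.transpose_transpose, Matrix.conjTranspose_mul]
    calc _ = (V ⊗ₖ W) * ((matA ψ)ᵀ * (Uᵀ * Uᵀᴴ) * (matA ψ)ᵀᴴ) * (V ⊗ₖ W)ᴴ := by
          simp only [Matrix.mul_assoc]
      _ = _ := by rw [transpose_isometry hU, Matrix.mul_one]
  have hK := kronecker_isometry hV (map_star_isometry hW)
  unfold I5
  rw [hρ, partialTranspose_conj]
  generalize V ⊗ₖ W.map star = K at hK
  generalize partialTranspose (rhoBC ψ) = M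
  have h3 : (K * M * Kᴴ) ^ 3 = K * M ^ 3 * Kᴴ := by
    calc _ = K * M * (Kᴴ * K) * M * (Kᴴ * K) * M * Kᴴ := by
          simp only [pow_succ, pow_zero, one_mul, Matrix.mul_assoc]
      _ = _ := by
          rw [hK]
          simp only [pow_succ, pow_zero, one_mul, Matrix.mul_assoc]
  rw [h3, Matrix.trace_mul_comm, ← Matrix.mul_assoc, hK, Matrix.one_mul]

theorem marginal_conj {m n : Type*} [Fintype m] [Fintype n] [DecidableEq n]
    (U : Matrix m m ℂ) (X : Matrix m n ℂ) {K : Matrix n n ℂ} (hK : Kᴴ * K = 1) :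
    (U * X * Kᵀ) * (U * X * Kᵀ)ᴴ = U * (X * Xᴴ) * Uᴴ := by
  simp only [Matrix.conjTranspose_mul]
  calc _ = U * X * (Kᵀ * Kᵀᴴ) * Xᴴ * Uᴴ := by simp only [Matrix.mul_assoc]
    _ = _ := by rw [transpose_isometry hK]; simp only [Matrix.mul_assoc, Matrix.one_mul]

/-- A Hermitian `2 × 2` matrix is diagonalised by a unitary matrix, with the eigenvalues in
decreasing order. -/
theorem exists_unitary_diagonal (H : Matrix (Fin 2) (Fin 2) ℂ) (hH : H.IsHermitian) :
    ∃ U ∈ Matrix.unitaryGroup (Fin 2) ℂ, ∃ d : Fin 2 → ℝ, d 1 ≤ d 0 ∧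
      U * H * Uᴴ = Matrix.diagonal fun i => (d i : ℂ) := by
  obtain ⟨U, hU, d, h⟩ : ∃ U ∈ Matrix.unitaryGroup (Fin 2) ℂ, ∃ d : Fin 2 → ℝ,
      U * H * Uᴴ = Matrix.diagonal fun i => (d i : ℂ) := by
    refine ⟨star (hH.eigenvectorUnitary : Matrix (Fin 2) (Fin 2) ℂ),
      (star hH.eigenvectorUnitary).2, hH.eigenvalues, ?_⟩
    have := hH.conjStarAlgAut_star_eigenvectorUnitary
    rw [Unitary.conjStarAlgAut_apply] at this
    simpa [Matrix.star_eq_conjTranspose, Function.comp_def] using this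
  rcases le_total (d 1) (d 0) with hd | hd
  · exact ⟨U, hU, d, hd, h⟩
  -- Wrong order of eigenvalues: compose with the swap of the two basis vectors.
  · have hS : !![0, 1; 1, 0] ∈ Matrix.unitaryGroup (Fin 2) ℂ := by
      rw [Matrix.mem_unitaryGroup_iff]
      ext i j
      fin_cases i <;> fin_cases j <;>
        simp [Matrix.mul_apply, Fin.sum_univ_two, Matrix.star_apply]
    refine ⟨!![0, 1; 1, 0] * U, mul_mem hS hU, ![d 1, d 0], by simpa using hd, ?_⟩
    rw [Matrix.conjTranspose_mul]
    calc _ = !![0, 1; 1, 0] * (U * H * Uᴴ) * (!![0, 1; 1, 0])ᴴ := by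
          simp only [Matrix.mul_assoc]
      _ = _ := by
        rw [h]
        ext i j
        fin_cases i <;> fin_cases j <;>
          simp [Matrix.mul_apply, Fin.sum_univ_two, Matrix.vecMul, dotProduct]

/-! ### The extremal problem for biases and correlations -/

theorem bloch_inequality {a b c u v w T : ℝ} (ha : 0 ≤ a) (hb : 0 ≤ b) (hc : 0 ≤ c)
    (hu : T = a * b * u) (hv : T = a * c * v) (hw : T = b * c * w)
    (h1 : -1 ≤ u + v + w) (h2 : 2 * (a + b + c) - 3 ≤ u + v + w) (hT : T ≤ -1 / 27) :
    T = -1 / 27 ∧ a = 1 / 3 ∧ b = 1 / 3 ∧ c = 1 / 3 ∧ u + v + w = -1 := by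
  have ha' : 0 < a := ha.lt_of_ne (by rintro rfl; simp at hu; linarith)
  have hb' : 0 < b := hb.lt_of_ne (by rintro rfl; simp at hu; linarith)
  have hc' : 0 < c := hc.lt_of_ne (by rintro rfl; simp at hv; linarith)
  obtain ⟨s, hs⟩ : ∃ s, s = a + b + c := ⟨_, rfl⟩
  obtain ⟨S, hS⟩ : ∃ S, S = u + v + w := ⟨_, rfl⟩
  obtain ⟨P, hP⟩ : ∃ P, P = a * b * c := ⟨_, rfl⟩
  have hP0 : 0 < P := by rw [hP]; positivity
  have hs0 : 0 < s := by rw [hs]; positivity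
  -- Weighting the three expressions for `T` by `c`, `b`, `a` leaves only symmetric quantities.
  have hsT : s * T = P * S := by
    rw [hs, hP, hS]; linear_combination c * hu + b * hv + a * hw
  have hdiff : s ^ 3 - 27 * P = s / 2 * ((a - b) ^ 2 + (b - c) ^ 2 + (c - a) ^ 2) +
      3 * (a * (b - c) ^ 2 + b * (c - a) ^ 2 + c * (a - b) ^ 2) := by
    rw [hs, hP]; ring
  have hamgm : 27 * P ≤ s ^ 3 := by
    have : 0 ≤ s ^ 3 - 27 * P := by rw [hdiff]; positivity
    linarith
  rw [← hs, ← hS] at h2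
  rw [← hS] at h1
  -- The bound S ≥ −1 gives s ≤ 27P ≤ s³.
  have hs1 : 1 ≤ s := by
    have e1 : -P ≤ s * T := by rw [hsT]; nlinarith
    have e2 : s * T ≤ s * (-1 / 27) := mul_le_mul_of_nonneg_left hT hs0.le
    have e3 : s * 1 ≤ s * s ^ 2 := by nlinarith
    have e4 := le_of_mul_le_mul_left e3 hs0
    nlinarith
  -- The other bound gives s ≤ 27P(3 − 2s) ≤ s³(3 − 2s), that is, (2s + 1)(s − 1)² ≤ 0.
  have hs2 : s = 1 := by
    have e1 : P * (2 * s - 3) ≤ s * T := by rw [hsT]; exact mul_le_mul_of_nonneg_left h2 hP0.le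
    have e2 : s * T ≤ s * (-1 / 27) := mul_le_mul_of_nonneg_left hT hs0.le
    have e0 : 2 * s - 3 ≤ 0 := by
      by_contra h
      have : 0 < P * (2 * s - 3) := mul_pos hP0 (by linarith)
      linarith
    have e3 : s * 1 ≤ s * (s ^ 2 * (3 - 2 * s)) := by
      nlinarith [mul_le_mul_of_nonneg_right hamgm (show 0 ≤ 3 - 2 * s by linarith)]
    have e4 := le_of_mul_le_mul_left e3 hs0
    have e5 : (2 * s + 1) * (s - 1) ^ 2 ≤ 0 := by linarith
    have e6 : (s - 1) ^ 2 ≤ 0 := by nlinarith [sq_nonneg (s - 1)]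
    have := pow_eq_zero_iff two_ne_zero |>.1 (le_antisymm e6 (sq_nonneg _))
    linarith
  rw [hs2] at hsT hamgm hdiff
  have hP1 : P = 1 / 27 := by nlinarith
  have hS1 : S = -1 := by rw [hP1] at hsT; linarith
  have hq : 0 ≤ a * (b - c) ^ 2 + b * (c - a) ^ 2 + c * (a - b) ^ 2 := by positivity
  -- Equality in AM-GM: s³ = 27P, so the nonnegative terms of `hdiff` vanish.
  have hQ : (a - b) ^ 2 + (b - c) ^ 2 + (c - a) ^ 2 ≤ 0 := by
    generalize a * (b - c) ^ 2 + b * (c - a) ^ 2 + c * (a - b) ^ 2 = q at hq hdiff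
    generalize (a - b) ^ 2 + (b - c) ^ 2 + (c - a) ^ 2 = Q at hdiff ⊢
    rw [hP1] at hdiff
    linarith
  have n1 := sq_nonneg (a - b)
  have n2 := sq_nonneg (b - c)
  have n3 := sq_nonneg (c - a)
  have hab : a - b = 0 := pow_eq_zero_iff two_ne_zero |>.1 (by linarith)
  have hbc : b - c = 0 := pow_eq_zero_iff two_ne_zero |>.1 (by linarith)
  refine ⟨?_, by linarith, by linarith, by linarith, by linarith⟩
  rw [hP1, hS1] at hsT
  linarith

/-- A probability distribution on bit strings of length three whose marginals `dA`, `dB`, `dC` favour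
`0` and for which Kempe's invariant is the same for all three pairs of bits. -/
theorem kempe_distribution {p : Fin 2 → Fin 2 → Fin 2 → ℝ} {dA dB dC : Fin 2 → ℝ} {t : ℝ}
    (hp : ∀ a b c, 0 ≤ p a b c) (hp1 : ∑ a, ∑ b, ∑ c, p a b c = 1)
    (hdA : ∀ a, dA a = ∑ b, ∑ c, p a b c) (hdB : ∀ b, dB b = ∑ a, ∑ c, p a b c)
    (hdC : ∀ c, dC c = ∑ a, ∑ b, p a b c)
    (hA : dA 1 ≤ dA 0) (hB : dB 1 ≤ dB 0) (hC : dC 1 ≤ dC 0)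
    (hAB : t = 3 * (∑ a, ∑ b, ∑ c, p a b c * dA a * dB b) - ∑ i, dA i ^ 3 - ∑ i, dB i ^ 3)
    (hAC : t = 3 * (∑ a, ∑ b, ∑ c, p a b c * dA a * dC c) - ∑ i, dA i ^ 3 - ∑ i, dC i ^ 3)
    (hBC : t = 3 * (∑ a, ∑ b, ∑ c, p a b c * dB b * dC c) - ∑ i, dB i ^ 3 - ∑ i, dC i ^ 3)
    (ht : t ≤ 2 / 9) :
    t = 2 / 9 ∧ p 1 0 0 = 1 / 3 ∧ p 0 1 0 = 1 / 3 ∧ p 0 0 1 = 1 / 3 ∧ p 0 0 0 = 0 ∧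
      p 0 1 1 = 0 ∧ p 1 0 1 = 0 ∧ p 1 1 0 = 0 ∧ p 1 1 1 = 0 := by
  have h000 := hp 0 0 0
  have h001 := hp 0 0 1
  have h010 := hp 0 1 0
  have h011 := hp 0 1 1
  have h100 := hp 1 0 0
  have h101 := hp 1 0 1
  have h110 := hp 1 1 0
  have h111 := hp 1 1 1
  have a0 := hdA 0
  have a1 := hdA 1
  have b0 := hdB 0
  have b1 := hdB 1
  have c0 := hdC 0
  have c1 := hdC 1
  simp only [Fin.sum_univ_two] at *
  generalize p 0 0 0 = p0 at *
  generalize p 0 0 1 = p1 at *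
  generalize p 0 1 0 = p2 at *
  generalize p 0 1 1 = p3 at *
  generalize p 1 0 0 = p4 at *
  generalize p 1 0 1 = p5 at *
  generalize p 1 1 0 = p6 at *
  generalize p 1 1 1 = p7 at *
  generalize dA 0 = A at *
  generalize dB 0 = B at *
  generalize dC 0 = C at *
  have eA : dA 1 = 1 - A := by linarith
  have eB : dB 1 = 1 - B := by linarith
  have eC : dC 1 = 1 - C := by linarith
  rw [eA] at hA a1 hAB hAC
  rw [eB] at hB b1 hAB hBC
  rw [eC] at hC c1 hAC hBC
  -- The linear bounds hold string by string: the three pair signs sum to −1 or 3, and 3 − 2(sum of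
  -- bit signs) + (sum of pair signs) is 0, 0, 4, 12 for weights 0, 1, 2, 3. Equality in both leaves
  -- only weight one, and the biases 1/3 then fix the probabilities.
  obtain ⟨hT, ha, hb, hc, hs⟩ := bloch_inequality (a := 2 * A - 1) (b := 2 * B - 1)
    (c := 2 * C - 1) (u := p0 + p1 - p2 - p3 - p4 - p5 + p6 + p7)
    (v := p0 - p1 + p2 - p3 - p4 + p5 - p6 + p7) (w := p0 - p1 - p2 + p3 + p4 - p5 - p6 + p7)
    (T := (4 * t - 1) / 3) (by linarith) (by linarith) (by linarith)
    (by linear_combination (4 / 3) * hAB + (3 - 2 * A - 2 * B) * hp1 -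
      2 * (2 * A - 1) * a0 - 2 * (2 * B - 1) * b0)
    (by linear_combination (4 / 3) * hAC + (3 - 2 * A - 2 * C) * hp1 -
      2 * (2 * A - 1) * a0 - 2 * (2 * C - 1) * c0)
    (by linear_combination (4 / 3) * hBC + (3 - 2 * B - 2 * C) * hp1 -
      2 * (2 * B - 1) * b0 - 2 * (2 * C - 1) * c0)
    (by linarith) (by linarith) (by linarith)
  refine ⟨by linarith, ?_, ?_, ?_, ?_, ?_, ?_, ?_, ?_⟩ <;> linarith

/-! ### Kempe's invariant and its three expressions -/

/-- Kempe's invariant as a polynomial in the amplitudes `x` and in their conjugates `y`, written as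
the trace of the cube of the partial transpose. -/
def kempe {R : Type*} [CommRing R] (x y : Fin 2 → Fin 2 → Fin 2 → R) : R :=
  ∑ p : Fin 2 × Fin 2, ∑ q : Fin 2 × Fin 2, ∑ r : Fin 2 × Fin 2,
    (∑ a, x a p.1 q.2 * y a q.1 p.2) * (∑ a, x a q.1 r.2 * y a r.1 q.2) *
      (∑ a, x a r.1 p.2 * y a p.1 r.2)

-- Treating the conjugate amplitudes `y` as independent of `x` makes this a polynomial identity in
-- commuting variables.
set_option maxHeartbeats 4000000 in
theorem kempe_BC {R : Type*} [CommRing R] (x y : Fin 2 → Fin 2 → Fin 2 → R)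
    (β γ : Fin 2 → Fin 2 → R)
    (hβ : ∀ i j, β i j = ∑ a, ∑ c, x a i c * y a j c)
    (hγ : ∀ i j, γ i j = ∑ a, ∑ b, x a b i * y a b j) :
    kempe x y = 3 * (∑ a, ∑ b, ∑ c, ∑ b', ∑ c', x a b c * y a b' c' * β b' b * γ c' c)
      - (∑ i, ∑ j, ∑ k, β i j * β j k * β k i) - (∑ i, ∑ j, ∑ k, γ i j * γ j k * γ k i) := by
  simp only [kempe, Fintype.sum_prod_type, Fin.sum_univ_two, hβ, hγ]
  ring

set_option maxHeartbeats 4000000 in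
theorem kempe_AC {R : Type*} [CommRing R] (x y : Fin 2 → Fin 2 → Fin 2 → R)
    (α γ : Fin 2 → Fin 2 → R)
    (hα : ∀ i j, α i j = ∑ b, ∑ c, x i b c * y j b c)
    (hγ : ∀ i j, γ i j = ∑ a, ∑ b, x a b i * y a b j) :
    kempe x y = 3 * (∑ a, ∑ b, ∑ c, ∑ a', ∑ c', x a b c * y a' b c' * α a' a * γ c' c)
      - (∑ i, ∑ j, ∑ k, α i j * α j k * α k i) - (∑ i, ∑ j, ∑ k, γ i j * γ j k * γ k i) := by
  simp only [kempe, Fintype.sum_prod_type, Fin.sum_univ_two, hα, hγ]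
  ring

set_option maxHeartbeats 4000000 in
theorem kempe_AB {R : Type*} [CommRing R] (x y : Fin 2 → Fin 2 → Fin 2 → R)
    (α β : Fin 2 → Fin 2 → R)
    (hβ : ∀ i j, β i j = ∑ a, ∑ c, x a i c * y a j c)
    (hα : ∀ i j, α i j = ∑ b, ∑ c, x i b c * y j b c) :
    kempe x y = 3 * (∑ a, ∑ b, ∑ c, ∑ a', ∑ b', x a b c * y a' b' c * α a' a * β b' b)
      - (∑ i, ∑ j, ∑ k, α i j * α j k * α k i) - (∑ i, ∑ j, ∑ k, β i j * β j k * β k i) := by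
  simp only [kempe, Fintype.sum_prod_type, Fin.sum_univ_two, hβ, hα]
  ring

theorem coe_I5_eq_kempe (ψ : Space) :
    (I5 ψ : ℂ) = kempe (fun a b c => ψ (a, b, c)) (fun a b c => star (ψ (a, b, c))) := by
  rw [coe_I5, trace_pow_three]
  simp [kempe, partialTranspose, rhoBC, traceA, proj, Matrix.vecMulVec_apply]

theorem marginalA_apply (ψ : Space) (i j : Fin 2) :
    (matA ψ * (matA ψ)ᴴ) i j = ∑ b, ∑ c, ψ (i, b, c) * star (ψ (j, b, c)) := by
  simp [matA, Matrix.mul_apply, Fintype.sum_prod_type]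

theorem marginalB_apply (ψ : Space) (i j : Fin 2) :
    (matB ψ * (matB ψ)ᴴ) i j = ∑ a, ∑ c, ψ (a, i, c) * star (ψ (a, j, c)) := by
  simp [matB, Matrix.mul_apply, Fintype.sum_prod_type]

theorem marginalC_apply (ψ : Space) (i j : Fin 2) :
    (matC ψ * (matC ψ)ᴴ) i j = ∑ a, ∑ b, ψ (a, b, i) * star (ψ (a, b, j)) := by
  simp [matC, Matrix.mul_apply, Fintype.sum_prod_type]

theorem mul_star_eq_norm_sq (z : ℂ) : z * star z = ((‖z‖ ^ 2 : ℝ) : ℂ) := by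
  rw [Complex.star_def, Complex.mul_conj, Complex.normSq_eq_norm_sq]

section Diagonal

variable {ψ : Space} {dA dB dC : Fin 2 → ℝ}

theorem diagonalA_eq (hA : matA ψ * (matA ψ)ᴴ = Matrix.diagonal fun i => (dA i : ℂ)) (a : Fin 2) :
    dA a = ∑ b, ∑ c, ‖ψ (a, b, c)‖ ^ 2 := by
  have h := congrFun (congrFun hA a) a
  simp only [marginalA_apply, mul_star_eq_norm_sq, Matrix.diagonal_apply_eq] at h
  exact_mod_cast h.symm

theorem diagonalB_eq (hB : matB ψ * (matB ψ)ᴴ = Matrix.diagonal fun i => (dB i : ℂ)) (b : Fin 2) :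
    dB b = ∑ a, ∑ c, ‖ψ (a, b, c)‖ ^ 2 := by
  have h := congrFun (congrFun hB b) b
  simp only [marginalB_apply, mul_star_eq_norm_sq, Matrix.diagonal_apply_eq] at h
  exact_mod_cast h.symm

theorem diagonalC_eq (hC : matC ψ * (matC ψ)ᴴ = Matrix.diagonal fun i => (dC i : ℂ)) (c : Fin 2) :
    dC c = ∑ a, ∑ b, ‖ψ (a, b, c)‖ ^ 2 := by
  have h := congrFun (congrFun hC c) c
  simp only [marginalC_apply, mul_star_eq_norm_sq, Matrix.diagonal_apply_eq] at h
  exact_mod_cast h.symm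

theorem I5_eq_AB (hA : matA ψ * (matA ψ)ᴴ = Matrix.diagonal fun i => (dA i : ℂ))
    (hB : matB ψ * (matB ψ)ᴴ = Matrix.diagonal fun i => (dB i : ℂ)) :
    I5 ψ = 3 * (∑ a, ∑ b, ∑ c, ‖ψ (a, b, c)‖ ^ 2 * dA a * dB b) - ∑ i, dA i ^ 3 -
      ∑ i, dB i ^ 3 := by
  have h := coe_I5_eq_kempe ψ
  rw [kempe_AB _ _ (matA ψ * (matA ψ)ᴴ) (matB ψ * (matB ψ)ᴴ) (marginalB_apply ψ)
    (marginalA_apply ψ), hA, hB] at h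
  have h' : ∀ a b c, ((‖ψ (a, b, c)‖ ^ 2 : ℝ) : ℂ) = ψ (a, b, c) * star (ψ (a, b, c)) :=
    fun a b c => (mul_star_eq_norm_sq _).symm
  apply Complex.ofReal_injective
  rw [h]
  simp only [Fin.sum_univ_two, Complex.ofReal_sub, Complex.ofReal_add, Complex.ofReal_mul, h']
  simp
  ring

theorem I5_eq_AC (hA : matA ψ * (matA ψ)ᴴ = Matrix.diagonal fun i => (dA i : ℂ))
    (hC : matC ψ * (matC ψ)ᴴ = Matrix.diagonal fun i => (dC i : ℂ)) :
    I5 ψ = 3 * (∑ a, ∑ b, ∑ c, ‖ψ (a, b, c)‖ ^ 2 * dA a * dC c) - ∑ i, dA i ^ 3 -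
      ∑ i, dC i ^ 3 := by
  have h := coe_I5_eq_kempe ψ
  rw [kempe_AC _ _ (matA ψ * (matA ψ)ᴴ) (matC ψ * (matC ψ)ᴴ) (marginalA_apply ψ)
    (marginalC_apply ψ), hA, hC] at h
  have h' : ∀ a b c, ((‖ψ (a, b, c)‖ ^ 2 : ℝ) : ℂ) = ψ (a, b, c) * star (ψ (a, b, c)) :=
    fun a b c => (mul_star_eq_norm_sq _).symm
  apply Complex.ofReal_injective
  rw [h]
  simp only [Fin.sum_univ_two, Complex.ofReal_sub, Complex.ofReal_add, Complex.ofReal_mul, h']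
  simp
  ring

theorem I5_eq_BC (hB : matB ψ * (matB ψ)ᴴ = Matrix.diagonal fun i => (dB i : ℂ))
    (hC : matC ψ * (matC ψ)ᴴ = Matrix.diagonal fun i => (dC i : ℂ)) :
    I5 ψ = 3 * (∑ a, ∑ b, ∑ c, ‖ψ (a, b, c)‖ ^ 2 * dB b * dC c) - ∑ i, dB i ^ 3 -
      ∑ i, dC i ^ 3 := by
  have h := coe_I5_eq_kempe ψ
  rw [kempe_BC _ _ (matB ψ * (matB ψ)ᴴ) (matC ψ * (matC ψ)ᴴ) (marginalB_apply ψ)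
    (marginalC_apply ψ), hB, hC] at h
  have h' : ∀ a b c, ((‖ψ (a, b, c)‖ ^ 2 : ℝ) : ℂ) = ψ (a, b, c) * star (ψ (a, b, c)) :=
    fun a b c => (mul_star_eq_norm_sq _).symm
  apply Complex.ofReal_injective
  rw [h]
  simp only [Fin.sum_univ_two, Complex.ofReal_sub, Complex.ofReal_add, Complex.ofReal_mul, h']
  simp
  ring

end Diagonal

theorem sum_norm_sq_eq_trace (ψ : Space) :
    (((∑ a, ∑ b, ∑ c, ‖ψ (a, b, c)‖ ^ 2 : ℝ)) : ℂ) = Matrix.trace (matA ψ * (matA ψ)ᴴ) := by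
  simp only [Matrix.trace, Matrix.diag_apply, marginalA_apply, mul_star_eq_norm_sq]
  push_cast
  rfl

theorem sum_norm_sq (ψ : Space) : ∑ a, ∑ b, ∑ c, ‖ψ (a, b, c)‖ ^ 2 = ‖ψ‖ ^ 2 := by
  simp [EuclideanSpace.norm_sq_eq, Fintype.sum_prod_type]

/-! ### The W state and its phases -/

theorem wState_apply (a b c : Fin 2) :
    wState (a, b, c) = if (a, b, c) ∈ ({(1, 0, 0), (0, 1, 0), (0, 0, 1)} :
      Finset (Fin 2 × Fin 2 × Fin 2)) then ((Real.sqrt 3 : ℝ) : ℂ)⁻¹ else 0 := by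
  fin_cases a <;> fin_cases b <;> fin_cases c <;> simp [wState, ket]

theorem I5_wState : I5 wState = 2 / 9 := by
  have hB : matB wState * (matB wState)ᴴ =
      Matrix.diagonal fun i => ((![2 / 3, 1 / 3] i : ℝ) : ℂ) := by
    ext i j
    rw [marginalB_apply]
    fin_cases i <;> fin_cases j <;>
      simp [wState_apply, Fin.sum_univ_two, ← mul_inv, ← Complex.ofReal_mul]
    all_goals norm_num
  have hC : matC wState * (matC wState)ᴴ =
      Matrix.diagonal fun i => ((![2 / 3, 1 / 3] i : ℝ) : ℂ) := by
    ext i j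
    rw [marginalC_apply]
    fin_cases i <;> fin_cases j <;>
      simp [wState_apply, Fin.sum_univ_two, ← mul_inv, ← Complex.ofReal_mul]
    all_goals norm_num
  rw [I5_eq_BC hB hC]
  simp [Fin.sum_univ_two, wState_apply]
  norm_num

theorem unitary_diag_one {e : ℂ} (he : e * star e = 1) :
    !![1, 0; 0, e] ∈ Matrix.unitaryGroup (Fin 2) ℂ := by
  rw [Matrix.mem_unitaryGroup_iff]
  ext i j
  fin_cases i <;> fin_cases j <;>
    simp [Matrix.mul_apply, Fin.sum_univ_two, Matrix.star_apply]
  simpa using he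

theorem exists_phase {z : ℂ} (hz : ‖z‖ ^ 2 = 1 / 3) :
    ∃ e : ℂ, e * star e = 1 ∧ e * z = ((Real.sqrt 3 : ℝ) : ℂ)⁻¹ := by
  have h := mul_star_eq_norm_sq z
  rw [hz] at h
  have h3 : ((Real.sqrt 3 : ℝ) : ℂ) * ((Real.sqrt 3 : ℝ) : ℂ) = 3 := by
    rw [← Complex.ofReal_mul, Real.mul_self_sqrt (by norm_num)]
    norm_num
  push_cast at h
  refine ⟨((Real.sqrt 3 : ℝ) : ℂ) * star z, ?_, ?_⟩
  · simp only [star_mul', Complex.star_def, Complex.conj_ofReal, Complex.conj_conj] at h ⊢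
    linear_combination (starRingEnd ℂ z * z) * h3 + 3 * h
  · apply eq_inv_of_mul_eq_one_left
    linear_combination (star z * z) * h3 + 3 * h

theorem LUEquivalent_of_localAct {U V W : Matrix (Fin 2) (Fin 2) ℂ}
    (hU : U ∈ Matrix.unitaryGroup (Fin 2) ℂ) (hV : V ∈ Matrix.unitaryGroup (Fin 2) ℂ)
    (hW : W ∈ Matrix.unitaryGroup (Fin 2) ℂ) {ψ φ : Space}
    (h : LUEquivalent (localAct U V W ψ) φ) : LUEquivalent ψ φ := by
  obtain ⟨U', hU', V', hV', W', hW', rfl⟩ := h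
  exact ⟨U' * U, mul_mem hU' hU, V' * V, mul_mem hV' hV, W' * W, mul_mem hW' hW,
    localAct_localAct U' V' W' U V W ψ⟩

/-- Each ket in W has exactly one bit equal to 1, so `diag(1, phase)` on the three qubits corrects
the three amplitudes independently. -/
theorem LUEquivalent_wState_of_norm_sq {φ : Space} (h100 : ‖φ (1, 0, 0)‖ ^ 2 = 1 / 3)
    (h010 : ‖φ (0, 1, 0)‖ ^ 2 = 1 / 3) (h001 : ‖φ (0, 0, 1)‖ ^ 2 = 1 / 3)
    (h000 : φ (0, 0, 0) = 0) (h011 : φ (0, 1, 1) = 0) (h101 : φ (1, 0, 1) = 0)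
    (h110 : φ (1, 1, 0) = 0) (h111 : φ (1, 1, 1) = 0) : LUEquivalent φ wState := by
  obtain ⟨e, he, he'⟩ := exists_phase h100
  obtain ⟨f, hf, hf'⟩ := exists_phase h010
  obtain ⟨g, hg, hg'⟩ := exists_phase h001
  refine ⟨_, unitary_diag_one he, _, unitary_diag_one hf, _, unitary_diag_one hg, ?_⟩
  ext ⟨i, j, k⟩
  rw [wState_apply]
  fin_cases i <;> fin_cases j <;> fin_cases k <;>
    simp [Matrix.mulVec, dotProduct, Fintype.sum_prod_type, Fin.sum_univ_two, *]

/-! ### Reduction to diagonal marginals and conclusion -/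

/-- A local unitary brings the three one-qubit marginals to diagonal form. -/
theorem exists_diagonal_marginals (ψ : Space) :
    ∃ U ∈ Matrix.unitaryGroup (Fin 2) ℂ, ∃ V ∈ Matrix.unitaryGroup (Fin 2) ℂ,
    ∃ W ∈ Matrix.unitaryGroup (Fin 2) ℂ, ∃ dA dB dC : Fin 2 → ℝ,
      dA 1 ≤ dA 0 ∧ dB 1 ≤ dB 0 ∧ dC 1 ≤ dC 0 ∧
      matA (localAct U V W ψ) * (matA (localAct U V W ψ))ᴴ =
        (Matrix.diagonal fun i => (dA i : ℂ)) ∧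
      matB (localAct U V W ψ) * (matB (localAct U V W ψ))ᴴ =
        (Matrix.diagonal fun i => (dB i : ℂ)) ∧
      matC (localAct U V W ψ) * (matC (localAct U V W ψ))ᴴ =
        (Matrix.diagonal fun i => (dC i : ℂ)) ∧
      Matrix.trace (matA (localAct U V W ψ) * (matA (localAct U V W ψ))ᴴ) =
        Matrix.trace (matA ψ * (matA ψ)ᴴ) := by
  obtain ⟨U, hU, dA, hdA, hA⟩ := exists_unitary_diagonal _
    (Matrix.isHermitian_mul_conjTranspose_self (matA ψ))
  obtain ⟨V, hV, dB, hdB, hB⟩ := exists_unitary_diagonal _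
    (Matrix.isHermitian_mul_conjTranspose_self (matB ψ))
  obtain ⟨W, hW, dC, hdC, hC⟩ := exists_unitary_diagonal _
    (Matrix.isHermitian_mul_conjTranspose_self (matC ψ))
  have hU' : Uᴴ * U = 1 := Matrix.mem_unitaryGroup_iff'.1 hU
  have hV' : Vᴴ * V = 1 := Matrix.mem_unitaryGroup_iff'.1 hV
  have hW' : Wᴴ * W = 1 := Matrix.mem_unitaryGroup_iff'.1 hW
  refine ⟨U, hU, V, hV, W, hW, dA, dB, dC, hdA, hdB, hdC, ?_, ?_, ?_, ?_⟩
  · rw [matA_localAct, marginal_conj _ _ (kronecker_isometry hV' hW'), hA]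
  · rw [matB_localAct, marginal_conj _ _ (kronecker_isometry hU' hW'), hB]
  · rw [matC_localAct, marginal_conj _ _ (kronecker_isometry hU' hV'), hC]
  · rw [matA_localAct, marginal_conj _ _ (kronecker_isometry hV' hW'), Matrix.trace_mul_comm,
      ← Matrix.mul_assoc, hU', Matrix.one_mul]

/-- Assuming only `≤` yields the lower bound and the equality case at once. -/
theorem I5_le_imp {ψ : Space} (hψ : ‖ψ‖ = 1) (h : I5 ψ ≤ 2 / 9) :
    I5 ψ = 2 / 9 ∧ LUEquivalent ψ wState := by
  obtain ⟨U, hU, V, hV, W, hW, dA, dB, dC, hdA, hdB, hdC, hA, hB, hC, htr⟩ :=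
    exists_diagonal_marginals ψ
  have hI : I5 (localAct U V W ψ) = I5 ψ := I5_localAct (Matrix.mem_unitaryGroup_iff'.1 hU)
    (Matrix.mem_unitaryGroup_iff'.1 hV) (Matrix.mem_unitaryGroup_iff'.1 hW) ψ
  have hsum : ∑ a, ∑ b, ∑ c, ‖(localAct U V W ψ) (a, b, c)‖ ^ 2 = 1 := by
    apply Complex.ofReal_injective
    rw [sum_norm_sq_eq_trace, htr, ← sum_norm_sq_eq_trace, sum_norm_sq, hψ, one_pow]
  obtain ⟨ht, h100, h010, h001, h000, h011, h101, h110, h111⟩ :=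
    kempe_distribution (p := fun a b c => ‖(localAct U V W ψ) (a, b, c)‖ ^ 2)
      (fun a b c => sq_nonneg _) hsum (diagonalA_eq hA) (diagonalB_eq hB) (diagonalC_eq hC)
      hdA hdB hdC (I5_eq_AB hA hB) (I5_eq_AC hA hC) (I5_eq_BC hB hC) (hI.trans_le h)
  have h0 : ∀ {z : ℂ}, ‖z‖ ^ 2 = 0 → z = 0 := fun hz => by simpa using hz
  exact ⟨hI.symm.trans ht, LUEquivalent_of_localAct hU hV hW (LUEquivalent_wState_of_norm_sq
    h100 h010 h001 (h0 h000) (h0 h011) (h0 h101) (h0 h110) (h0 h111))⟩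

end ThreeQubit

theorem proposition8 (ψ : ThreeQubit.Space) (hψ : ‖ψ‖ = 1) :
    2 / 9 ≤ ThreeQubit.I5 ψ ∧
      (ThreeQubit.I5 ψ = 2 / 9 ↔ ThreeQubit.LUEquivalent ψ ThreeQubit.wState) := by
  refine ⟨?_, fun h => (ThreeQubit.I5_le_imp hψ h.le).2, ?_⟩
  · rcases le_total (ThreeQubit.I5 ψ) (2 / 9) with h | h
    · exact (ThreeQubit.I5_le_imp hψ h).1.ge
    · exact h
  · rintro ⟨U, hU, V, hV, W, hW, h⟩
    rw [← ThreeQubit.I5_wState, h]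
    exact (ThreeQubit.I5_localAct (Matrix.mem_unitaryGroup_iff'.1 hU)
      (Matrix.mem_unitaryGroup_iff'.1 hV) (Matrix.mem_unitaryGroup_iff'.1 hW) ψ).symm
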